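/- \textbf{Setting.} Let $G=(V,E)$ be a finite connected graph with a colouring $\omega : V \to C$ (not necessarily proper) from a colour-set $C$. A move $(v,d)$, with $v\in V$ and $d\in C$, gives colour $d$ to all vertices in the same monochromatic component as $v$ with respect to the current colouring, i.e. to all vertices joined to $v$ by a path of $G$ whose vertices all have the current colour of $v$. For $d\in C$, let $m(G,\omega,d)$ be the minimum number of moves required to give all vertices of $G$ colour $d$, starting from $\omega$. A spanning tree $T$ of $G$ is called $d$-minimal if $m(T,\omega,d)=m(G,\omega,d)$, where the game defining $m(T,\omega,d)$ is played on $T$ with the same initial colouring $\omega$. A leaf of a tree is a vertex with exactly one neighbour. \textbf{Lemma.} Let $G$, with a colouring $\omega$ from a colour-set $C$, be the graph of a $2\times n$ board: its vertices are the $2n$ squares, and two squares are adjacent if they are horizontally or vertically adjacent. Let $H$ be a (nonempty) connected induced subgraph of $G$, coloured by the restriction of $\omega$, and let $u$ and $w$ be vertices of $H$ lying respectively in the leftmost and in the rightmost column that contains a vertex of $H$. Then, for every $d\in C$, there exists a $d$-minimal spanning tree $T$ of $H$ such that every vertex of $T$ that is not a leaf lies on the unique path from $u$ to $w$ in $T$.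 -/

import Mathlib

namespace FloodIt

variable {V C : Type*}

/-- The subgraph of `G` formed by the edges whose two ends have the same colour under `ω`.
Its connected components are the monochromatic components of `G` with respect to `ω`. -/
def monoGraph (G : SimpleGraph V) (ω : V → C) : SimpleGraph V where
  Adj a b := G.Adj a b ∧ ω a = ω b
  symm := ⟨fun _ _ h => ⟨h.1.symm, h.2.symm⟩⟩
  loopless := ⟨fun _ h => h.1.ne rfl⟩

open Classical in
/-- The colouring obtained from `ω` by the move `(v, d)`: every vertex in the same monochromatic
component of `G` as `v` is given colour `d`. -/
noncomputable def move (G : SimpleGraph V) (ω : V → C) (a : V × C) : V → C :=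
  fun x => if (monoGraph G ω).Reachable a.1 x then a.2 else ω x

/-- The colouring obtained from `ω` by playing the moves of the sequence `S` in order. -/
noncomputable def play (G : SimpleGraph V) (ω : V → C) (S : List (V × C)) : V → C :=
  S.foldl (move G) ω

/-- The sequence `S`, played in `G` from the initial colouring `ω`, floods `G` with colour `d`. -/
def Floods (G : SimpleGraph V) (ω : V → C) (S : List (V × C)) (d : C) : Prop :=
  ∀ x, play G ω S x = d

/-- `m(G, ω, d)`: the minimum number of moves required to give every vertex of `G` colour `d`. -/
noncomputable def minMoves (G : SimpleGraph V) (ω : V → C) (d : C) : ℕ :=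
  sInf {k | ∃ S : List (V × C), S.length = k ∧ Floods G ω S d}

/-- On a finite vertex set some sequence of moves always floods the graph, so `minMoves` is the
minimum of a nonempty set. -/
theorem exists_floods [Finite V] (G : SimpleGraph V) (ω : V → C) (d : C) :
    ∃ S : List (V × C), Floods G ω S d := by
  have key : ∀ (l : List V) (ω : V → C) (x : V), (x ∈ l ∨ ω x = d) →
      play G ω (l.map fun v => (v, d)) x = d := by
    intro l
    induction l with
    | nil => intro ω x h; simpa [play] using h
    | cons v l ih =>
      intro ω x h
      refine ih (move G ω (v, d)) x ?_
      by_cases hx : x ∈ l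
      · exact Or.inl hx
      · right
        unfold move
        split_ifs with hr
        · rfl
        · rcases h with h | h
          · rcases List.mem_cons.1 h with rfl | h
            · exact absurd (SimpleGraph.Reachable.refl x) hr
            · exact absurd h hx
          · exact h
  cases nonempty_fintype V
  exact ⟨_, fun x => key Finset.univ.toList ω x (Or.inl (by simp))⟩

/-- `T` is a spanning tree of `G`. -/
def IsSpanningTree (G T : SimpleGraph V) : Prop :=
  T ≤ G ∧ T.IsTree

/-- `T` is a `d`-minimal spanning tree of `G`, with respect to the colouring `ω`. -/
def IsMinimalSpanningTree (G : SimpleGraph V) (ω : V → C) (d : C) (T : SimpleGraph V) : Prop :=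
  IsSpanningTree G T ∧ minMoves T ω d = minMoves G ω d

/-- `v` is a leaf of `T`: it has exactly one neighbour. -/
def IsLeaf (T : SimpleGraph V) (v : V) : Prop :=
  ∃! y, T.Adj v y

/-- The vertices left after deleting all leaves of `T`. -/
def bare (T : SimpleGraph V) : Set V :=
  {v | ¬ IsLeaf T v}

/-- The graph of the `2 × n` board: the square in row `i` and column `j` is the vertex `(i, j)`,
and squares are adjacent when they are horizontally or vertically adjacent. -/
def board (n : ℕ) : SimpleGraph (Fin 2 × Fin n) :=
  SimpleGraph.boxProd (SimpleGraph.pathGraph 2) (SimpleGraph.pathGraph n)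

end FloodIt

/-! Moves are replaced by assemblies (`Fill`): sets are built from cells by joining disjoint
touching sets of equal colour at no cost and by recolouring a set at cost one. For a connected
graph, `minMoves` is the least cost of assembling all vertices from singletons
(`minMoves_le_of_fill`, `fill_minMoves`). Assemblies pass from a graph to any larger one, so a
spanning tree is minimal as soon as some optimal assembly of the graph can be carried out in it.

On a two-row board the tree is a comb: all vertical edges and one horizontal edge between
consecutive columns. `exists_comb_fill` goes by induction on the cost. The last recolourings act on
pairwise non-touching blocks, each assembled more cheaply beforehand and hence in a comb. Two
vertices in one column are equal or adjacent, so non-touching blocks cross different gaps between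
columns and their combs merge into one. Gaps crossed by no block are free: any edge there will do.

A comb is acyclic, and a walk between the extreme columns uses all its horizontal edges, so a vertex
off the walk has a single, vertical edge. -/

namespace FloodIt

variable {V C : Type*}

/-! ### Touching and connected sets. -/

/-- Some edge of `G` joins `A` to `B`. -/
def Touch (G : SimpleGraph V) (A B : Set V) : Prop :=
  ∃ x ∈ A, ∃ y ∈ B, G.Adj x y

theorem Touch.symm {G : SimpleGraph V} {A B : Set V} (h : Touch G A B) : Touch G B A := by
  obtain ⟨x, hx, y, hy, hxy⟩ := h
  exact ⟨y, hy, x, hx, hxy.symm⟩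

theorem Touch.mono {G : SimpleGraph V} {A B A' B' : Set V} (h : Touch G A B)
    (hA : A ⊆ A') (hB : B ⊆ B') : Touch G A' B' := by
  obtain ⟨x, hx, y, hy, hxy⟩ := h
  exact ⟨x, hA hx, y, hB hy, hxy⟩

/-- `X` cannot be split into two nonempty parts without an edge of `G` between them. -/
def Conn (G : SimpleGraph V) (X : Set V) : Prop :=
  ∀ A B : Set V, A ∪ B = X → Disjoint A B → A.Nonempty → B.Nonempty → Touch G A B

/-- A connected set covered by two parts without an edge between them lies in one part; the edge
between `A` and `B` then forces both into the same part. -/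
theorem Conn.union {G : SimpleGraph V} {A B : Set V} (hA : Conn G A) (hB : Conn G B)
    (h : Touch G A B) : Conn G (A ∪ B) := by
  have key : ∀ D P Q : Set V, Conn G D → D ⊆ P ∪ Q → Disjoint P Q → ¬ Touch G P Q →
      D ⊆ P ∨ D ⊆ Q := by
    intro D P Q hD hs hPQ hn
    by_contra! hc
    obtain ⟨a, ha, haP⟩ := Set.not_subset.1 hc.1
    obtain ⟨b, hb, hbQ⟩ := Set.not_subset.1 hc.2
    refine hn ((hD (D ∩ P) (D ∩ Q) ?_ ?_ ⟨b, hb, (hs hb).resolve_right hbQ⟩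
      ⟨a, ha, (hs ha).resolve_left haP⟩).mono Set.inter_subset_right Set.inter_subset_right)
    · rw [← Set.inter_union_distrib_left, Set.inter_eq_left.2 hs]
    · exact hPQ.mono Set.inter_subset_right Set.inter_subset_right
  intro P Q hPQ hd ⟨x, hx⟩ ⟨y, hy⟩
  by_contra hn
  have hx' : x ∈ A ∪ B := hPQ ▸ Or.inl hx
  have hy' : y ∈ A ∪ B := hPQ ▸ Or.inr hy
  have hxQ : x ∉ Q := fun h => Set.disjoint_left.1 hd hx h
  have hyP : y ∉ P := fun h => Set.disjoint_left.1 hd h hy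
  have h1 := key A P Q hA (hPQ ▸ Set.subset_union_left) hd hn
  have h2 := key B P Q hB (hPQ ▸ Set.subset_union_right) hd hn
  rcases h1 with h1 | h1 <;> rcases h2 with h2 | h2
  · exact hyP (hy'.elim (fun h => h1 h) fun h => h2 h)
  · exact hn (h.mono h1 h2)
  · exact hn (h.symm.mono h2 h1)
  · exact hxQ (hx'.elim (fun h => h1 h) fun h => h2 h)

/-- A set closed under adjacency in a subgraph `M` of `G`, any two vertices of which are joined
in `M`, is connected in `G`. -/
theorem conn_of_reachable {G M : SimpleGraph V} (hM : M ≤ G) {X : Set V}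
    (hX : ∀ a ∈ X, ∀ b ∈ X, M.Reachable a b) (hc : ∀ a ∈ X, ∀ b, M.Adj a b → b ∈ X) :
    Conn G X := by
  intro A B hAB hd ⟨a, ha⟩ ⟨b, hb⟩
  have haX : a ∈ X := hAB ▸ Or.inl ha
  have hbX : b ∈ X := hAB ▸ Or.inr hb
  obtain ⟨w⟩ := hX a haX b hbX
  obtain ⟨e, -, h1, h2⟩ := w.exists_boundary_dart A ha (Set.disjoint_right.1 hd hb)
  have h3 : e.snd ∈ A ∪ B := hAB ▸ hc _ (hAB ▸ Or.inl h1) _ e.adj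
  exact ⟨_, h1, _, h3.resolve_left h2, hM e.adj⟩

theorem conn_univ {G : SimpleGraph V} (hG : G.Connected) : Conn G Set.univ :=
  conn_of_reachable le_rfl (fun a _ b _ => hG.preconnected a b) fun _ _ _ _ => Set.mem_univ _

theorem preconnected_of_conn {G : SimpleGraph V} (h : Conn G Set.univ) : G.Preconnected := by
  intro a b
  by_contra hab
  obtain ⟨x, hx, y, hy, hxy⟩ := h {x | G.Reachable a x} {x | ¬ G.Reachable a x}
    (by ext x; simp [em]) (Set.disjoint_left.2 fun x hx hx' => hx' hx)
    ⟨a, SimpleGraph.Reachable.refl a⟩ ⟨b, hab⟩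
  exact hy (hx.trans hxy.reachable)

/-! ### Assemblies of vertex sets. -/

/-- `Fill G ω p X d k`: starting from the cells of the labelling `p`, each in its colour under
`ω`, the set `X` can be assembled in colour `d` by joining disjoint touching sets of equal colour
and by recolouring sets `k` times. -/
inductive Fill (G : SimpleGraph V) (ω : V → C) (p : V → V) : Set V → C → ℕ → Prop
  | cell (v : V) : Fill G ω p {x | p x = p v} (ω v) 0
  | join {A B : Set V} {d : C} {a b : ℕ} : Fill G ω p A d a → Fill G ω p B d b →
      Disjoint A B → Touch G A B → Fill G ω p (A ∪ B) d (a + b)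
  | recolour {A : Set V} {c : C} {a : ℕ} (d : C) : Fill G ω p A c a → Fill G ω p A d (a + 1)

namespace Fill

variable {G : SimpleGraph V} {ω : V → C} {p : V → V}

theorem nonempty {X : Set V} {d : C} {k : ℕ} (h : Fill G ω p X d k) : X.Nonempty := by
  induction h with
  | cell v => exact ⟨v, rfl⟩
  | join _ _ _ _ ih _ => exact ih.inl
  | recolour _ _ ih => exact ih

/-- Assembling a set uses only the edges inside the set. -/
theorem mono_graph {G' : SimpleGraph V} {X : Set V} {d : C} {k : ℕ} (h : Fill G ω p X d k)
    (hG : ∀ x ∈ X, ∀ y ∈ X, G.Adj x y → G'.Adj x y) : Fill G' ω p X d k := by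
  induction h with
  | cell v => exact cell v
  | join _ _ hd ht ih1 ih2 =>
    obtain ⟨x, hx, y, hy, hxy⟩ := ht
    exact join (ih1 fun x hx y hy => hG x (Or.inl hx) y (Or.inl hy))
      (ih2 fun x hx y hy => hG x (Or.inr hx) y (Or.inr hy)) hd
      ⟨x, hx, y, hy, hG x (Or.inl hx) y (Or.inr hy) hxy⟩
  | recolour d _ ih => exact recolour d (ih hG)

theorem conn {X : Set V} {d : C} {k : ℕ} (h : Fill G ω id X d k) : Conn G X := by
  induction h with
  | cell v =>
    rintro A B hAB hd ⟨a, ha⟩ ⟨b, hb⟩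
    have h1 : a ∈ {x | id x = id v} := hAB ▸ Or.inl ha
    have h2 : b ∈ {x | id x = id v} := hAB ▸ Or.inr hb
    have h3 : a = b := h1.trans h2.symm
    exact absurd (h3 ▸ hb) (Set.disjoint_left.1 hd ha)
  | join _ _ _ ht ih1 ih2 => exact ih1.union ih2 ht
  | recolour _ _ ih => exact ih

end Fill

/-! ### Growth from a seed. -/

/-- Growing a set from the seed `L` of colour `c`, by joining to it sets satisfying `Fill` and by
recolouring it. -/
inductive Grow (G : SimpleGraph V) (ω : V → C) (p : V → V) (L : Set V) (c : C) :
    Set V → C → ℕ → Prop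
  | base : Grow G ω p L c L c 0
  | join {X B : Set V} {d : C} {k b : ℕ} : Grow G ω p L c X d k → Fill G ω p B d b →
      Disjoint X B → Touch G X B → Grow G ω p L c (X ∪ B) d (k + b)
  | recolour {X : Set V} {e : C} {k : ℕ} (d : C) : Grow G ω p L c X e k →
      Grow G ω p L c X d (k + 1)

namespace Grow

variable {G : SimpleGraph V} {ω : V → C} {p : V → V} {c : C}

theorem seed_subset {L X : Set V} {d : C} {k : ℕ} (h : Grow G ω p L c X d k) : L ⊆ X := by
  induction h with
  | base => exact subset_rfl
  | join _ _ _ _ ih => exact ih.trans Set.subset_union_left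
  | recolour _ _ ih => exact ih

/-- A growth process may be started from a larger set of the colour of the seed. -/
theorem fill_union {L X Z : Set V} {e : C} {k z : ℕ} (h : Grow G ω p L c X e k)
    (hZ : Fill G ω p Z c z) (hL : L ⊆ Z) (hd : Disjoint (X \ L) Z) :
    Fill G ω p (Z ∪ X) e (z + k) := by
  induction h with
  | base => rwa [Set.union_eq_left.2 hL, add_zero]
  | @join X B d k b hX hB hXB ht ih =>
    rw [← Set.union_assoc, ← add_assoc]
    refine (ih (hd.mono_left (Set.sdiff_subset_sdiff_left Set.subset_union_left))).join hB ?_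
      (ht.mono Set.subset_union_right subset_rfl)
    refine Set.disjoint_union_left.2 ⟨?_, hXB⟩
    refine (hd.mono_left fun x hx => ⟨Or.inr hx, fun hxL => ?_⟩).symm
    exact Set.disjoint_left.1 hXB (hX.seed_subset hxL) hx
  | recolour d _ ih => exact (ih hd).recolour d

/-- The growth of `Y` is replayed with `L₁` attached while the colour is still `c`. Just before the
first recolouring of `Y`, the whole growth of `X` is inserted; that recolouring then covers `X ∪ Y`,
so the final colour of `X` plays no role. The first alternative holds until this happens. -/
theorem fill_union_aux {L₁ L₂ X Y : Set V} {e f : C} {k l : ℕ}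
    (hL : Fill G ω p (L₁ ∪ L₂) c 0) (hX : Grow G ω p L₁ c X e k) (hY : Grow G ω p L₂ c Y f l)
    (hd : Disjoint X Y) :
    (f = c ∧ Fill G ω p (L₁ ∪ Y) c l) ∨ Fill G ω p (X ∪ Y) f (k + l) := by
  have lift : ∀ {Y : Set V} {l : ℕ}, Disjoint X Y → Fill G ω p (L₁ ∪ Y) c l →
      Fill G ω p (X ∪ Y) e (k + l) := by
    intro Y l hd h
    have h1 := hX.fill_union h Set.subset_union_left
      (Set.disjoint_union_right.2 ⟨Set.disjoint_sdiff_left, hd.mono_left Set.sdiff_subset⟩)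
    rwa [show L₁ ∪ Y ∪ X = X ∪ Y by
      rw [Set.union_right_comm, Set.union_eq_right.2 hX.seed_subset], add_comm] at h1
  induction hY with
  | base => exact Or.inl ⟨rfl, hL⟩
  | @join Y B d l b _ hB hYB ht ih =>
    have hd1 := hd.mono_right (Set.subset_union_left (s := Y) (t := B))
    have hd2 := hd.mono_right (Set.subset_union_right (s := Y) (t := B))
    rcases ih hd1 with ⟨rfl, h⟩ | h
    · left
      refine ⟨rfl, ?_⟩
      rw [← Set.union_assoc]
      exact h.join hB (Set.disjoint_union_left.2 ⟨hd2.mono_left hX.seed_subset, hYB⟩)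
        (ht.mono Set.subset_union_right subset_rfl)
    · right
      rw [← Set.union_assoc, ← add_assoc]
      exact h.join hB (Set.disjoint_union_left.2 ⟨hd2, hYB⟩)
        (ht.mono Set.subset_union_right subset_rfl)
  | recolour d _ ih =>
    right
    rcases ih hd with ⟨rfl, h⟩ | h
    · exact (lift hd h).recolour d
    · exact h.recolour d

/-- Two disjoint sets grown to the same colour from touching seeds of equal colour can be
assembled jointly from the union of the seeds, without additional recolourings. -/
theorem fill_union_of_grow {L₁ L₂ X Y : Set V} {e : C} {k l : ℕ}
    (hL : Fill G ω p (L₁ ∪ L₂) c 0) (hX : Grow G ω p L₁ c X e k) (hY : Grow G ω p L₂ c Y e l)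
    (hd : Disjoint X Y) : Fill G ω p (X ∪ Y) e (k + l) := by
  induction hX with
  | base =>
    rcases fill_union_aux hL base hY hd with ⟨-, h⟩ | h
    · rwa [zero_add]
    · exact h
  | @join X B d k b hX hB hXB ht ih =>
    have hd1 := hd.mono_left (Set.subset_union_left (s := X) (t := B))
    have hd2 := hd.mono_left (Set.subset_union_right (s := X) (t := B))
    rw [Set.union_right_comm, add_right_comm]
    exact (ih hY hd1).join hB (Set.disjoint_union_left.2 ⟨hXB, hd2.symm⟩)
      (ht.mono Set.subset_union_left subset_rfl)
  | @recolour X f k d hX _ =>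
    rw [add_right_comm]
    rcases fill_union_aux hL hX hY hd with ⟨rfl, h⟩ | h
    · have h1 := hX.fill_union h Set.subset_union_left
        (Set.disjoint_union_right.2 ⟨Set.disjoint_sdiff_left, hd.mono_left Set.sdiff_subset⟩)
      rw [show L₁ ∪ Y ∪ X = X ∪ Y by
        rw [Set.union_right_comm, Set.union_eq_right.2 hX.seed_subset], add_comm] at h1
      exact h1.recolour _
    -- The union already has the target colour; this redundant recolouring only matches the count.
    · exact h.recolour _

end Grow

/-! ### Enlarging cells to monochromatic components. -/

open Classical in
/-- The labelling obtained from `p` by merging the cells of `x` and `y`. -/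
noncomputable def mergeCells (p : V → V) (x y : V) : V → V :=
  fun v => if p v = p y then p x else p v

theorem mergeCells_left (p : V → V) (x y : V) : mergeCells p x y x = p x := by
  unfold mergeCells; split_ifs <;> rfl

theorem mergeCells_eq_iff (p : V → V) (x y v : V) :
    mergeCells p x y v = p x ↔ p v = p x ∨ p v = p y := by
  unfold mergeCells; split_ifs with h <;> simp [h]

/-- Merging two adjacent cells of equal colour does not increase the number of recolourings. -/
theorem Fill.merge {G : SimpleGraph V} {ω : V → C} {p : V → V}
    (hp : ∀ a b, p a = p b → ω a = ω b) {x y : V} (hω : ω x = ω y) {X : Set V} {d : C} {k : ℕ}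
    (h : Fill G ω p X d k) :
    ((x ∈ X ↔ y ∈ X) → Fill G ω (mergeCells p x y) X d k) ∧
    (x ∈ X → y ∉ X → Grow G ω (mergeCells p x y) {v | p v = p x} (ω x) X d k) ∧
    (x ∉ X → y ∈ X → Grow G ω (mergeCells p x y) {v | p v = p y} (ω x) X d k) := by
  -- The two old cells form one new cell, free of cost. A set containing just one of `x`, `y` is no
  -- union of new cells, so it is tracked as a growth from its old cell until both halves meet in a
  -- join.
  have hL : Fill G ω (mergeCells p x y) ({v | p v = p x} ∪ {v | p v = p y}) (ω x) 0 := by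
    have := Fill.cell (G := G) (ω := ω) (p := mergeCells p x y) x
    simp only [mergeCells_left, mergeCells_eq_iff] at this
    exact this
  induction h with
  | cell v =>
    refine ⟨fun hxy => ?_, fun hx _ => ?_, fun _ hy => ?_⟩
    · by_cases hx : p x = p v
      · have hy : p y = p v := hxy.1 hx
        have := hL
        rwa [hx, hy, Set.union_self, hp x v hx] at this
      · have hy : p y ≠ p v := fun h => hx (hxy.2 h)
        have h1 : {u | p u = p v} = {u | mergeCells p x y u = mergeCells p x y v} := by
          ext u
          simp only [Set.mem_ofPred_eq, mergeCells, if_neg hy.symm]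
          split_ifs with hu
          · rw [hu]; exact ⟨fun h => absurd h hy, fun h => absurd h hx⟩
          · rfl
        rw [h1]
        exact Fill.cell v
    · have hx : p x = p v := hx
      rw [← hx, ← hp x v hx]
      exact Grow.base
    · have hy : p y = p v := hy
      rw [← hy, ← hp y v hy, ← hω]
      exact Grow.base
  | @join A B d a b hA hB hd ht ihA ihB =>
    have hnx : x ∈ A → x ∉ B := fun h => Set.disjoint_left.1 hd h
    have hny : y ∈ A → y ∉ B := fun h => Set.disjoint_left.1 hd h
    refine ⟨fun hxy => ?_, fun hx hy => ?_, fun hx hy => ?_⟩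
    · by_cases hA' : x ∈ A ↔ y ∈ A
      · exact (ihA.1 hA').join (ihB.1
          ⟨fun h => (hxy.1 (Or.inr h)).resolve_left fun h' => hnx (hA'.2 h') h,
            fun h => (hxy.2 (Or.inr h)).resolve_left fun h' => hny (hA'.1 h') h⟩) hd ht
      · by_cases hxA : x ∈ A
        · have hyA : y ∉ A := fun h => hA' (iff_of_true hxA h)
          exact Grow.fill_union_of_grow hL (ihA.2.1 hxA hyA)
            (ihB.2.2 (hnx hxA) ((hxy.1 (Or.inl hxA)).resolve_left hyA)) hd
        · have hyA : y ∈ A := by_contra fun h => hA' (iff_of_false hxA h)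
          rw [Set.union_comm, add_comm]
          exact Grow.fill_union_of_grow hL
            (ihB.2.1 ((hxy.2 (Or.inl hyA)).resolve_left hxA) (hny hyA))
            (ihA.2.2 hxA hyA) hd.symm
    · obtain ⟨hyA, hyB⟩ := not_or.1 hy
      by_cases hxA : x ∈ A
      · exact (ihA.2.1 hxA hyA).join (ihB.1 (iff_of_false (hnx hxA) hyB)) hd ht
      · rw [Set.union_comm, add_comm]
        exact (ihB.2.1 (hx.resolve_left hxA) hyB).join (ihA.1 (iff_of_false hxA hyA))
          hd.symm ht.symm
    · obtain ⟨hxA, hxB⟩ := not_or.1 hx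
      by_cases hyA : y ∈ A
      · exact (ihA.2.2 hxA hyA).join (ihB.1 (iff_of_false hxB (hny hyA))) hd ht
      · rw [Set.union_comm, add_comm]
        exact (ihB.2.2 hxB (hy.resolve_left hyA)).join (ihA.1 (iff_of_false hxA hyA))
          hd.symm ht.symm
  | recolour d _ ih =>
    exact ⟨fun h => (ih.1 h).recolour d, fun h h' => (ih.2.1 h h').recolour d,
      fun h h' => (ih.2.2 h h').recolour d⟩

theorem eq_of_reachable {G : SimpleGraph V} {α : Type*} {f : V → α}
    (h : ∀ a b, G.Adj a b → f a = f b) {a b : V} (hab : G.Reachable a b) : f a = f b := by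
  obtain ⟨w⟩ := hab
  induction w with
  | nil => rfl
  | cons e _ ih => exact (h _ _ e).trans ih

theorem colour_eq_of_reachable {G : SimpleGraph V} {ω : V → C} {a b : V}
    (hab : (monoGraph G ω).Reachable a b) : ω a = ω b :=
  eq_of_reachable (G := monoGraph G ω) (fun _ _ h => h.2) hab

/-- The cells may be enlarged to the monochromatic components. -/
theorem Fill.exists_components [Finite V] {G : SimpleGraph V} {ω : V → C} {d : C} {k : ℕ}
    {p : V → V} (hp : ∀ a b, p a = p b → (monoGraph G ω).Reachable a b)
    (h : Fill G ω p Set.univ d k) :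
    ∃ q : V → V, (∀ a b, q a = q b ↔ (monoGraph G ω).Reachable a b) ∧
      Fill G ω q Set.univ d k := by
  induction hn : (Set.range p).ncard using Nat.strong_induction_on generalizing p with
  | _ n ih =>
    by_cases hf : ∀ a b, (monoGraph G ω).Adj a b → p a = p b
    · exact ⟨p, fun a b => ⟨hp a b, eq_of_reachable hf⟩, h⟩
    push Not at hf
    obtain ⟨x, y, hxy, hne⟩ := hf
    refine ih _ ?_ (p := mergeCells p x y) ?_
      ((h.merge (fun a b hab => colour_eq_of_reachable (hp a b hab)) hxy.2).1 (by simp)) rfl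
    · rw [← hn]
      -- The label `p y` disappears from the range.
      refine Set.ncard_lt_ncard ⟨?_, fun hs => ?_⟩
      · rintro _ ⟨v, rfl⟩
        unfold mergeCells
        split_ifs
        exacts [⟨x, rfl⟩, ⟨v, rfl⟩]
      · obtain ⟨v, hv⟩ := hs ⟨y, rfl⟩
        unfold mergeCells at hv
        split_ifs at hv with h1
        exacts [hne hv, h1 hv]
    · have key : ∀ a, mergeCells p x y a = p x → (monoGraph G ω).Reachable a x := by
        intro a ha
        rcases (mergeCells_eq_iff p x y a).1 ha with ha | ha
        exacts [hp _ _ ha, (hp _ _ ha).trans hxy.symm.reachable]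
      intro a b hab
      by_cases hb : mergeCells p x y b = p x
      · exact (key a (hab.trans hb)).trans (key b hb).symm
      · have ha : mergeCells p x y a ≠ p x := fun h => hb (hab.symm.trans h)
        rw [Ne, mergeCells_eq_iff, not_or] at ha
        rw [mergeCells_eq_iff, not_or] at hb
        refine hp a b ?_
        simpa [mergeCells, ha.2, hb.2] using hab

/-! ### From assemblies to moves. -/

theorem move_eq_of_reachable {G : SimpleGraph V} {ω : V → C} {v x : V} {e : C}
    (h : (monoGraph G ω).Reachable v x) : move G ω (v, e) x = e := if_pos h

theorem move_eq_of_not_reachable {G : SimpleGraph V} {ω : V → C} {v x : V} {e : C}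
    (h : ¬ (monoGraph G ω).Reachable v x) : move G ω (v, e) x = ω x := if_neg h

theorem monoGraph_le_move (G : SimpleGraph V) (ω : V → C) (m : V × C) :
    monoGraph G ω ≤ monoGraph G (move G ω m) := by
  intro a b hab
  refine ⟨hab.1, ?_⟩
  have : (monoGraph G ω).Reachable m.1 a ↔ (monoGraph G ω).Reachable m.1 b :=
    ⟨fun h => h.trans hab.reachable, fun h => h.trans hab.symm.reachable⟩
  unfold move
  split_ifs <;> first | rfl | exact hab.2 | tauto

namespace Fill

variable {G : SimpleGraph V} {ω : V → C} {p : V → V}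

/-- An assembled set is a union of cells, here monochromatic components, so a move at a vertex
outside it changes no colour in it. -/
theorem move_of_notMem (hp : ∀ a b, p a = p b ↔ (monoGraph G ω).Reachable a b) {X : Set V}
    {d e : C} {k : ℕ} {v : V} (h : Fill G ω p X d k) (hv : v ∉ X) :
    Fill G (move G ω (v, e)) p X d k := by
  induction h with
  | cell u =>
    have := Fill.cell (G := G) (ω := move G ω (v, e)) (p := p) u
    rwa [move_eq_of_not_reachable fun hr => hv ((hp _ _).2 hr)] at this
  | join _ _ hd ht ih1 ih2 =>
    exact (ih1 fun h => hv (Or.inl h)).join (ih2 fun h => hv (Or.inr h)) hd ht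
  | recolour d _ ih => exact (ih hv).recolour d

/-- Distinct components that touch have different colours, so no join is possible before the first
recolouring. -/
theorem eq_cell_of_zero (hp : ∀ a b, p a = p b ↔ (monoGraph G ω).Reachable a b) {X : Set V}
    {d : C} {k : ℕ} (h : Fill G ω p X d k) (hk : k = 0) :
    ∃ v, X = {x | p x = p v} ∧ ω v = d := by
  induction h with
  | cell v => exact ⟨v, rfl, rfl⟩
  | join _ _ hd ht ih1 ih2 =>
    obtain ⟨v, rfl, hv⟩ := ih1 (by omega)
    obtain ⟨w, rfl, hw⟩ := ih2 (by omega)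
    obtain ⟨x, hx, y, hy, hxy⟩ := ht
    have h1 : ω x = ω y := by
      rw [colour_eq_of_reachable ((hp _ _).1 hx), colour_eq_of_reachable ((hp _ _).1 hy), hv, hw]
    have h2 : p x = p y := (hp _ _).2 (SimpleGraph.Adj.reachable ⟨hxy, h1⟩)
    exact absurd (h2.trans hy) (Set.disjoint_left.1 hd hx)
  | recolour _ _ _ => omega

/-- An innermost recolouring acts on a single component, so it is a genuine move and can be played
first. -/
theorem exists_move (hp : ∀ a b, p a = p b ↔ (monoGraph G ω).Reachable a b) {X : Set V}
    {d : C} {k : ℕ} (h : Fill G ω p X d k) (hk : k ≠ 0) :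
    ∃ v ∈ X, ∃ e, Fill G (move G ω (v, e)) p X d (k - 1) := by
  induction h with
  | cell v => exact absurd rfl hk
  | @join A B d a b hA hB hd ht ih1 ih2 =>
    by_cases ha : a = 0
    · have hb : b ≠ 0 := by omega
      obtain ⟨v, hv, e, h⟩ := ih2 hb
      refine ⟨v, Or.inr hv, e, ?_⟩
      rw [Nat.add_sub_assoc (by omega)]
      exact (hA.move_of_notMem hp (Set.disjoint_right.1 hd hv)).join h hd ht
    · obtain ⟨v, hv, e, h⟩ := ih1 ha
      refine ⟨v, Or.inl hv, e, ?_⟩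
      rw [Nat.sub_add_comm (by omega)]
      exact h.join (hB.move_of_notMem hp (Set.disjoint_left.1 hd hv)) hd ht
  | @recolour A c a d hA ih =>
    by_cases ha : a = 0
    · obtain ⟨v, rfl, -⟩ := hA.eq_cell_of_zero hp ha
      refine ⟨v, rfl, d, ?_⟩
      have := Fill.cell (G := G) (ω := move G ω (v, d)) (p := p) v
      rw [move_eq_of_reachable (SimpleGraph.Reachable.refl v)] at this
      simpa [ha] using this
    · obtain ⟨v, hv, e, h⟩ := ih ha
      refine ⟨v, hv, e, ?_⟩
      have := h.recolour d
      rwa [Nat.sub_add_cancel (by omega)] at this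

/-- An assembly with `k` recolourings yields `k` moves that flood the graph. -/
theorem exists_floods [Finite V] {d : C} {k : ℕ} {ω : V → C} {p : V → V}
    (hp : ∀ a b, p a = p b → (monoGraph G ω).Reachable a b) (h : Fill G ω p Set.univ d k) :
    ∃ S : List (V × C), S.length = k ∧ Floods G ω S d := by
  induction k generalizing ω p with
  | zero =>
    obtain ⟨q, hq, hF⟩ := h.exists_components hp
    obtain ⟨v, hv, rfl⟩ := hF.eq_cell_of_zero hq rfl
    refine ⟨[], rfl, fun x => ?_⟩
    have hx : x ∈ {x | q x = q v} := hv ▸ Set.mem_univ x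
    exact colour_eq_of_reachable ((hq x v).1 hx)
  | succ k ih =>
    obtain ⟨q, hq, hF⟩ := h.exists_components hp
    obtain ⟨v, -, e, h'⟩ := hF.exists_move hq (Nat.succ_ne_zero k)
    -- After the move the cells may be smaller than the new components; the induction hypothesis
    -- asks only that cells lie inside components.
    obtain ⟨S, hS, hfl⟩ := ih
      (fun a b hab => ((hq a b).1 hab).mono (monoGraph_le_move G ω (v, e))) h'
    exact ⟨(v, e) :: S, by simp [hS], hfl⟩

end Fill

/-! ### Families of non-touching blocks. -/

/-- `Blocks G Q Y m`: the set `Y` is the union of pairwise disjoint sets, no two of which touch,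
each satisfying `Q` with some cost, and `m` is the sum of the costs. -/
inductive Blocks (G : SimpleGraph V) (Q : Set V → ℕ → Prop) : Set V → ℕ → Prop
  | empty : Blocks G Q ∅ 0
  | add {Y A : Set V} {m a : ℕ} : Blocks G Q Y m → Q A a → A.Nonempty → Disjoint Y A →
      ¬ Touch G Y A → Blocks G Q (Y ∪ A) (m + a)

namespace Blocks

variable {G : SimpleGraph V} {Q : Set V → ℕ → Prop}

/-- The new set absorbs every old block that it touches; costs add, so the total is unchanged. -/
theorem insert (hQ : ∀ A B a b, Q A a → Q B b → Disjoint A B → Touch G A B → Q (A ∪ B) (a + b))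
    {Y A : Set V} {m a : ℕ} (hY : Blocks G Q Y m) (hA : Q A a) (hne : A.Nonempty)
    (hd : Disjoint Y A) : Blocks G Q (Y ∪ A) (m + a) := by
  induction hY generalizing A a with
  | empty => exact empty.add hA hne hd fun ⟨x, hx, _⟩ => hx
  | @add Y B m b hY hB hneB hYB hn ih =>
    obtain ⟨hYA, hBA⟩ := Set.disjoint_union_left.1 hd
    by_cases ht : Touch G B A
    · rw [Set.union_assoc, add_assoc]
      exact ih (hQ _ _ _ _ hB hA hBA ht) hneB.inl (Set.disjoint_union_right.2 ⟨hYB, hYA⟩)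
    · rw [Set.union_right_comm, add_right_comm]
      refine (ih hA hne hYA).add hB hneB (Set.disjoint_union_left.2 ⟨hYB, hBA.symm⟩) ?_
      rintro ⟨x, hx | hx, y, hy, hxy⟩
      · exact hn ⟨x, hx, y, hy, hxy⟩
      · exact ht ⟨y, hy, x, hx, hxy.symm⟩

theorem union (hQ : ∀ A B a b, Q A a → Q B b → Disjoint A B → Touch G A B → Q (A ∪ B) (a + b))
    {Y Z : Set V} {m n : ℕ} (hY : Blocks G Q Y m) (hZ : Blocks G Q Z n) (hd : Disjoint Y Z) :
    Blocks G Q (Y ∪ Z) (m + n) := by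
  induction hZ with
  | empty => simpa using hY
  | add _ hA hne hZA _ ih =>
    obtain ⟨h1, h2⟩ := Set.disjoint_union_right.1 hd
    rw [← Set.union_assoc, ← add_assoc]
    exact (ih h1).insert hQ hA hne (Set.disjoint_union_left.2 ⟨h2, hZA⟩)

theorem eq_zero_of_empty {Y : Set V} {m : ℕ} (h : Blocks G Q Y m) (hY : Y = ∅) : m = 0 := by
  cases h with
  | empty => rfl
  | add _ _ hne _ _ => exact absurd (Set.union_empty_iff.1 hY).2 hne.ne_empty

theorem of_conn {X : Set V} {m : ℕ} (h : Blocks G Q X m) (hX : Conn G X) (hne : X.Nonempty) :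
    Q X m := by
  cases h with
  | empty => exact absurd rfl hne.ne_empty
  | @add Y A m a hY hA hneA hd hn =>
    rcases Y.eq_empty_or_nonempty with rfl | hneY
    · rwa [hY.eq_zero_of_empty rfl, Set.empty_union, zero_add]
    · exact absurd (hX Y A rfl hd hneY hneA) hn

/-- The bound `a ≤ m` on the cost of a block is what makes induction on the cost available in
`exists_comb_fill`. -/
theorem imp {G' : SimpleGraph V} {Q' : Set V → ℕ → Prop} {Y : Set V} {m : ℕ}
    (h : Blocks G Q Y m) (hG : G' ≤ G) (hQ : ∀ A ⊆ Y, ∀ a ≤ m, Q A a → Q' A a) :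
    Blocks G' Q' Y m := by
  induction h with
  | empty => exact empty
  | add _ hA hne hd hn ih =>
    refine (ih fun B hB b hb => hQ B (hB.trans Set.subset_union_left) b (by omega)).add
      (hQ _ Set.subset_union_right _ (by omega) hA) hne hd fun ⟨x, hx, y, hy, hxy⟩ =>
      hn ⟨x, hx, y, hy, hG hxy⟩

end Blocks

/-- A connected set is filled once some of its blocks are filled and the rest has the right
colour. -/
theorem Fill.of_blocks [Finite V] {G : SimpleGraph V} {ω : V → C} {d : C} {X Y : Set V} {k : ℕ}
    (hY : Blocks G (fun A a => Fill G ω id A d a) Y k) (hYX : Y ⊆ X)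
    (hd : ∀ x ∈ X, x ∉ Y → ω x = d) (hX : Conn G X) (hne : X.Nonempty) : Fill G ω id X d k := by
  have key : ∀ Z : Set V, Disjoint Y Z → Z ⊆ X →
      Blocks G (fun A a => Fill G ω id A d a) (Y ∪ Z) k := by
    intro Z hZ
    induction Z, Set.toFinite Z using Set.Finite.induction_on with
    | empty => intro _; rwa [Set.union_empty]
    | @insert z Z hz _ ih =>
      intro hs
      obtain ⟨h1, h2⟩ := Set.insert_subset_iff.1 hs
      obtain ⟨h3, h4⟩ := Set.disjoint_insert_right.1 hZ
      have hzd := hd z h1 h3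
      have hc : Fill G ω id {z} d 0 := hzd ▸ Fill.cell z
      rw [← Set.union_singleton, ← Set.union_assoc]
      exact (ih h4 h2).insert (fun _ _ _ _ hA hB => hA.join hB) hc (Set.singleton_nonempty z)
        (Set.disjoint_singleton_right.2 (by simp [h3, hz]))
  have := key (X \ Y) Set.disjoint_sdiff_right Set.sdiff_subset
  rw [Set.union_sdiff_cancel hYX] at this
  exact this.of_conn hX hne

theorem Fill.of_conn [Finite V] {G : SimpleGraph V} {ω : V → C} {d : C} {X : Set V}
    (hd : ∀ x ∈ X, ω x = d) (hX : Conn G X) (hne : X.Nonempty) : Fill G ω id X d 0 :=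
  Fill.of_blocks Blocks.empty (Set.empty_subset X) (fun x hx _ => hd x hx) hX hne

theorem Fill.extend [Finite V] {G : SimpleGraph V} {ω : V → C} {d : C} {X Y : Set V} {k : ℕ}
    (hY : Fill G ω id Y d k) (hYX : Y ⊆ X) (hd : ∀ x ∈ X, x ∉ Y → ω x = d) (hX : Conn G X) :
    Fill G ω id X d k := by
  refine Fill.of_blocks ?_ hYX hd hX (hY.nonempty.mono hYX)
  have := (Blocks.empty (G := G) (Q := fun A a => Fill G ω id A d a)).add hY hY.nonempty
    (Set.empty_disjoint Y) fun ⟨x, hx, _⟩ => hx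
  rwa [Set.empty_union, zero_add] at this

/-! ### From moves to assemblies. -/

theorem conn_component {G : SimpleGraph V} {ω : V → C} (v : V) :
    Conn G {x | (monoGraph G ω).Reachable v x} :=
  conn_of_reachable (M := monoGraph G ω) (fun _ _ h => h.1)
    (fun _ ha _ hb => SimpleGraph.Reachable.trans (SimpleGraph.Reachable.symm ha) hb)
    fun _ ha _ hab => SimpleGraph.Reachable.trans ha hab.reachable

open Classical in
/-- An assembly after a move gives an assembly before the move, with one more recolouring. -/
theorem Fill.of_move [Finite V] {G : SimpleGraph V} {ω : V → C} {v : V} {e : C} {q : V → V}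
    (hq : ∀ a b, q a = q b ↔ (monoGraph G (move G ω (v, e))).Reachable a b) {X : Set V} {d : C}
    {k : ℕ} (h : Fill G (move G ω (v, e)) q X d k) :
    Fill G ω id X d (k + if v ∈ X then 1 else 0) := by
  induction h with
  | cell u =>
    have hcell : {x | q x = q u} = {x | (monoGraph G (move G ω (v, e))).Reachable u x} := by
      ext x
      exact ⟨fun h => ((hq x u).1 h).symm, fun h => (hq x u).2 (SimpleGraph.Reachable.symm h)⟩
    have hsub : ∀ x, (monoGraph G ω).Reachable v x → q v = q x := fun x hx =>
      (hq v x).2 (hx.mono (monoGraph_le_move G ω (v, e)))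
    have hcol : ∀ x, q x = q u → move G ω (v, e) x = move G ω (v, e) u := fun x hx =>
      colour_eq_of_reachable ((hq x u).1 hx)
    have hconn : Conn G {x | q x = q u} := by rw [hcell]; exact conn_component u
    by_cases hv : q v = q u
    -- In the cell of `v`, only the old component of `v` has to be recoloured; the rest already has
    -- the colour of the cell.
    · have hK : Fill G ω id {x | (monoGraph G ω).Reachable v x} (ω v) 0 :=
        Fill.of_conn (fun x hx => (colour_eq_of_reachable hx).symm) (conn_component v)
          ⟨v, SimpleGraph.Reachable.refl v⟩
      have := (hK.recolour (move G ω (v, e) u)).extend (X := {x | q x = q u})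
        (fun x hx => (hsub x hx).symm.trans hv)
        (fun x hx hn => by rw [← hcol x hx, move_eq_of_not_reachable hn]) hconn
      rwa [if_pos (show v ∈ {x | q x = q u} from hv)]
    · rw [if_neg (show v ∉ {x | q x = q u} from hv)]
      refine Fill.of_conn (fun x hx => ?_) hconn ⟨u, rfl⟩
      rw [← hcol x hx, move_eq_of_not_reachable fun hr => hv ((hsub x hr).trans hx)]
  | @join A B d a b _ _ hd ht ih1 ih2 =>
    have := ih1.join ih2 hd ht
    convert this using 1
    by_cases hA : v ∈ A
    · have hB : v ∉ B := Set.disjoint_left.1 hd hA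
      simp [hA, hB]; omega
    · simp [hA]; omega
  | recolour d _ ih =>
    rw [add_right_comm]
    exact ih.recolour d

/-- A flooding sequence of moves gives an assembly with as many recolourings. -/
theorem Fill.of_floods [Finite V] {G : SimpleGraph V} (hG : G.Connected) {d : C}
    {S : List (V × C)} {ω : V → C} (h : Floods G ω S d) : Fill G ω id Set.univ d S.length := by
  induction S generalizing ω with
  | nil =>
    have := hG.nonempty
    exact Fill.of_conn (fun x _ => h x) (conn_univ hG) Set.univ_nonempty
  | cons m S ih =>
    -- With singleton cells the component moved would be split and each piece charged; enlarged
    -- cells keep it in one cell, charged once.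
    obtain ⟨q, hq, hF⟩ := (ih (ω := move G ω m) h).exists_components (fun a b hab => by
      rw [show a = b from hab])
    simpa using hF.of_move hq

theorem minMoves_le_of_fill [Finite V] {G : SimpleGraph V} {ω : V → C} {d : C} {k : ℕ}
    (h : Fill G ω id Set.univ d k) : minMoves G ω d ≤ k :=
  Nat.sInf_le (h.exists_floods fun a b hab => by rw [show a = b from hab])

theorem fill_minMoves [Finite V] {G : SimpleGraph V} (hG : G.Connected) (ω : V → C) (d : C) :
    Fill G ω id Set.univ d (minMoves G ω d) := by
  have hne : {k | ∃ S : List (V × C), S.length = k ∧ Floods G ω S d}.Nonempty := by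
    obtain ⟨S, hS⟩ := FloodIt.exists_floods G ω d
    exact ⟨_, S, rfl, hS⟩
  obtain ⟨S, hS, hfl⟩ := Nat.sInf_mem hne
  have := Fill.of_floods hG hfl
  rwa [hS] at this

/-! ### The last recolourings of an assembly. -/

/-- `A` can be assembled in some colour and then recoloured, with `m` recolourings in total. -/
def Recoloured (G : SimpleGraph V) (ω : V → C) (A : Set V) (m : ℕ) : Prop :=
  ∃ c a, m = a + 1 ∧ Fill G ω id A c a

/-- The last recolouring of `B` is redirected to the colour `A` has before its own last one, which
is then applied to the union. -/
theorem Recoloured.join {G : SimpleGraph V} {ω : V → C} (A B : Set V) (a b : ℕ)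
    (hA : Recoloured G ω A a) (hB : Recoloured G ω B b) (hd : Disjoint A B) (ht : Touch G A B) :
    Recoloured G ω (A ∪ B) (a + b) := by
  obtain ⟨c, a, rfl, hA⟩ := hA
  obtain ⟨_, b, rfl, hB⟩ := hB
  exact ⟨c, a + (b + 1), by omega, hA.join (hB.recolour c) hd ht⟩

/-- In an assembly, the last recolourings can be taken to affect pairwise non-touching blocks. -/
theorem Fill.exists_blocks {G : SimpleGraph V} {ω : V → C} {X : Set V} {d : C} {k : ℕ}
    (h : Fill G ω id X d k) :
    ∃ Y ⊆ X, Blocks G (Recoloured G ω) Y k ∧ ∀ x ∈ X, x ∉ Y → ω x = d := by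
  induction h with
  | cell v => exact ⟨∅, Set.empty_subset _, Blocks.empty, fun x hx _ => congrArg ω hx⟩
  | join _ _ hd _ ih1 ih2 =>
    obtain ⟨Y, hY, hB, hc⟩ := ih1
    obtain ⟨Z, hZ, hB', hc'⟩ := ih2
    refine ⟨Y ∪ Z, Set.union_subset_union hY hZ,
      hB.union Recoloured.join hB' (hd.mono hY hZ), fun x hx hn => ?_⟩
    obtain ⟨h1, h2⟩ := not_or.1 hn
    exact hx.elim (fun h => hc x h h1) fun h => hc' x h h2
  | @recolour A c a d h _ =>
    refine ⟨A, subset_rfl, ?_, fun x hx hn => absurd hx hn⟩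
    have := (Blocks.empty (G := G) (Q := Recoloured G ω)).add ⟨c, a, rfl, h⟩ h.nonempty
      (Set.empty_disjoint A) fun ⟨x, hx, _⟩ => hx
    rwa [Set.empty_union, zero_add] at this

/-! ### Two-row graphs and combs. -/

/-- `row` and `col` identify `G` with an induced subgraph of a board with two rows. -/
structure TwoRows (G : SimpleGraph V) (row : V → Fin 2) (col : V → ℕ) : Prop where
  adj_iff : ∀ x y, G.Adj x y ↔ (row x = row y ∧ (col x + 1 = col y ∨ col y + 1 = col x)) ∨
    (row x ≠ row y ∧ col x = col y)
  ext : ∀ x y, row x = row y → col x = col y → x = y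

/-- The subgraph of `G` formed by all vertical edges and by the edges in row `s j` between the
columns `j` and `j + 1`. -/
def comb (G : SimpleGraph V) (row : V → Fin 2) (col : V → ℕ) (s : ℕ → Fin 2) :
    SimpleGraph V where
  Adj x y := G.Adj x y ∧ (col x = col y ∨
    (row x = s (min (col x) (col y)) ∧ row y = s (min (col x) (col y))))
  symm := ⟨fun x y h => ⟨h.1.symm, h.2.imp Eq.symm fun h' => by
    rw [min_comm]; exact h'.symm⟩⟩
  loopless := ⟨fun _ h => h.1.ne rfl⟩

theorem comb_le (G : SimpleGraph V) (row : V → Fin 2) (col : V → ℕ) (s : ℕ → Fin 2) :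
    comb G row col s ≤ G := fun _ _ h => h.1

/-- Some edge of `G` inside `X` joins the columns `j` and `j + 1`. -/
def Crosses (G : SimpleGraph V) (col : V → ℕ) (X : Set V) (j : ℕ) : Prop :=
  ∃ x ∈ X, ∃ y ∈ X, G.Adj x y ∧ col x = j ∧ col y = j + 1

theorem Crosses.mono {G : SimpleGraph V} {col : V → ℕ} {X Y : Set V} {j : ℕ}
    (h : Crosses G col X j) (hXY : X ⊆ Y) : Crosses G col Y j := by
  obtain ⟨x, hx, y, hy, hxy⟩ := h
  exact ⟨x, hXY hx, y, hXY hy, hxy⟩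

namespace TwoRows

variable {G : SimpleGraph V} {row : V → Fin 2} {col : V → ℕ}

theorem col_cases (hG : TwoRows G row col) {x y : V} (h : G.Adj x y) :
    col x = col y ∨ col x + 1 = col y ∨ col y + 1 = col x := by
  rcases (hG.adj_iff x y).1 h with h | h
  exacts [Or.inr h.2, Or.inl h.2]

theorem row_eq (hG : TwoRows G row col) {x y : V} (h : G.Adj x y) (hc : col x ≠ col y) :
    row x = row y := by
  rcases (hG.adj_iff x y).1 h with h | h
  exacts [h.1, absurd h.2 hc]

theorem eq_or_adj (hG : TwoRows G row col) {x y : V} (h : col x = col y) :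
    x = y ∨ G.Adj x y := by
  by_cases hr : row x = row y
  · exact Or.inl (hG.ext x y hr h)
  · exact Or.inr ((hG.adj_iff x y).2 (Or.inr ⟨hr, h⟩))

/-- Two combs with the same rows at the columns crossed inside `X` agree on `X`. -/
theorem comb_adj_congr (hG : TwoRows G row col) {X : Set V} {s t : ℕ → Fin 2}
    (h : ∀ j, Crosses G col X j → s j = t j) {x y : V} (hx : x ∈ X) (hy : y ∈ X)
    (hxy : (comb G row col s).Adj x y) : (comb G row col t).Adj x y := by
  refine ⟨hxy.1, ?_⟩
  by_cases hc : col x = col y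
  · exact Or.inl hc
  have hst : s (min (col x) (col y)) = t (min (col x) (col y)) := by
    apply h
    rcases (hG.col_cases hxy.1).resolve_left hc with h1 | h1
    · exact ⟨x, hx, y, hy, hxy.1, by omega, by omega⟩
    · exact ⟨y, hy, x, hx, hxy.1.symm, by omega, by omega⟩
  rw [← hst]
  exact hxy.2

/-- The edges of a connected set cross all columns between those of its vertices. -/
theorem exists_crossing (hG : TwoRows G row col) {M : SimpleGraph V} (hM : M ≤ G) {X : Set V}
    (hX : Conn M X) {x y : V} {j : ℕ} (hx : x ∈ X) (hy : y ∈ X) (hxj : col x ≤ j)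
    (hjy : j < col y) : ∃ a ∈ X, ∃ b ∈ X, M.Adj a b ∧ col a = j ∧ col b = j + 1 := by
  obtain ⟨a, ha, b, hb, hab⟩ := hX {z ∈ X | col z ≤ j} {z ∈ X | ¬ col z ≤ j}
    (by ext z; by_cases h : col z ≤ j <;> simp [h]; intro; omega)
    (Set.disjoint_left.2 fun z hz hz' => hz'.2 hz.2) ⟨x, hx, hxj⟩ ⟨y, hy, by omega⟩
  have h1 : col a ≤ j := ha.2
  have h2 : ¬ col b ≤ j := hb.2
  have := hG.col_cases (hM hab)
  exact ⟨a, ha.1, b, hb.1, hab, by omega, by omega⟩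

/-- Sets that do not touch cross different columns. -/
theorem not_crosses (hG : TwoRows G row col) {X Y : Set V} (hd : Disjoint X Y)
    (hn : ¬ Touch G X Y) {j : ℕ} (hX : Crosses G col X j) : ¬ Crosses G col Y j := by
  rintro ⟨y, hy, -, -, -, hyj, -⟩
  obtain ⟨x, hx, -, -, -, hxj, -⟩ := hX
  rcases hG.eq_or_adj (hxj.trans hyj.symm) with rfl | h
  · exact Set.disjoint_left.1 hd hx hy
  · exact hn ⟨x, hx, y, hy, h⟩

theorem recoloured_congr (hG : TwoRows G row col) {ω : V → C} {s t : ℕ → Fin 2} {A : Set V}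
    {a : ℕ} (h : Recoloured (comb G row col s) ω A a) (hst : ∀ j, Crosses G col A j → s j = t j) :
    Recoloured (comb G row col t) ω A a := by
  obtain ⟨c, a, rfl, h⟩ := h
  exact ⟨c, a, rfl, h.mono_graph fun x hx y hy => hG.comb_adj_congr hst hx hy⟩

/-- If each block can be assembled in some comb, then one comb serves for all blocks. -/
theorem exists_comb_blocks (hG : TwoRows G row col) {ω : V → C} {Y : Set V} {m : ℕ}
    (h : Blocks G (fun A a => ∃ s, Recoloured (comb G row col s) ω A a) Y m) :
    ∃ s, Blocks G (Recoloured (comb G row col s) ω) Y m := by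
  classical
  induction h with
  | empty => exact ⟨fun _ => 0, Blocks.empty⟩
  | @add Y A m a _ hA hne hd hn ih =>
    obtain ⟨s, hs⟩ := ih
    obtain ⟨t, ht⟩ := hA
    refine ⟨fun j => if Crosses G col A j then t j else s j, Blocks.add
      (hs.imp le_rfl fun B hB b _ hb => hG.recoloured_congr hb fun j hj => ?_)
      (hG.recoloured_congr ht fun j hj => (if_pos hj).symm) hne hd hn⟩
    exact (if_neg (hG.not_crosses hd hn (hj.mono hB))).symm

/-- The columns crossed inside the blocks are crossed by edges of the comb. -/
theorem crosses_comb (hG : TwoRows G row col) {ω : V → C} {s : ℕ → Fin 2} {Y : Set V} {m : ℕ}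
    (h : Blocks G (Recoloured (comb G row col s) ω) Y m) {j : ℕ} (hj : Crosses G col Y j) :
    ∃ x ∈ Y, ∃ y ∈ Y, (comb G row col s).Adj x y ∧ col x = j ∧ col y = j + 1 := by
  induction h with
  | empty => obtain ⟨x, hx, -⟩ := hj; exact hx.elim
  | @add Y A m a _ hA hne hd hn ih =>
    obtain ⟨x, hx, y, hy, hxy, hxj, hyj⟩ := hj
    have left : Crosses G col Y j → ∃ x ∈ Y ∪ A, ∃ y ∈ Y ∪ A,
        (comb G row col s).Adj x y ∧ col x = j ∧ col y = j + 1 := fun h => by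
      obtain ⟨x, hx, y, hy, h⟩ := ih h
      exact ⟨x, Or.inl hx, y, Or.inl hy, h⟩
    rcases hx with hx | hx <;> rcases hy with hy | hy
    · exact left ⟨x, hx, y, hy, hxy, hxj, hyj⟩
    · exact absurd ⟨x, hx, y, hy, hxy⟩ hn
    · exact absurd ⟨y, hy, x, hx, hxy.symm⟩ hn
    · obtain ⟨c, a, rfl, hA⟩ := hA
      obtain ⟨a, ha, b, hb, h⟩ := hG.exists_crossing (comb_le G row col s) hA.conn hx hy
        hxj.le (by omega)
      exact ⟨a, Or.inr ha, b, Or.inr hb, h⟩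

/-- A comb with an edge at each column crossed inside the connected set `X` connects `X`. -/
theorem conn_comb (hG : TwoRows G row col) {s : ℕ → Fin 2} {X : Set V} (hX : Conn G X)
    (hs : ∀ j, Crosses G col X j →
      ∃ x ∈ X, ∃ y ∈ X, (comb G row col s).Adj x y ∧ col x = j ∧ col y = j + 1) :
    Conn (comb G row col s) X := by
  intro P Q hPQ hd hP hQ
  by_contra hn
  have vert : ∀ x ∈ X, ∀ y ∈ X, col x = col y → (x ∈ P ↔ y ∈ P) := by
    have one : ∀ x ∈ X, ∀ y ∈ X, col x = col y → x ∈ P → y ∈ P := by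
      intro x _ y hy hc hxP
      rcases hG.eq_or_adj hc with rfl | h
      · exact hxP
      · rw [← hPQ] at hy
        exact hy.resolve_right fun hyQ => hn ⟨x, hxP, y, hyQ, h, Or.inl hc⟩
    exact fun x hx y hy hc => ⟨one x hx y hy hc, one y hy x hx hc.symm⟩
  -- A horizontal edge missing from the comb is bypassed through the comb's edge between the same
  -- columns and vertical edges.
  have horiz : ∀ x ∈ X, ∀ y ∈ X, G.Adj x y → col x + 1 = col y → (x ∈ P ↔ y ∈ P) := by
    intro x hx y hy hxy hc
    obtain ⟨a, ha, b, hb, hab, haj, hbj⟩ := hs (col x) ⟨x, hx, y, hy, hxy, rfl, hc.symm⟩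
    rw [vert x hx a ha haj.symm, vert y hy b hb (by omega)]
    rw [← hPQ] at ha hb
    constructor
    · exact fun h => hb.resolve_right fun h' => hn ⟨a, h, b, h', hab⟩
    · exact fun h => ha.resolve_right fun h' => hn ⟨b, h, a, h', hab.symm⟩
  obtain ⟨x, hx, y, hy, hxy⟩ := hX P Q hPQ hd hP hQ
  have hxX : x ∈ X := hPQ ▸ Or.inl hx
  have hyX : y ∈ X := hPQ ▸ Or.inr hy
  refine Set.disjoint_right.1 hd hy ?_
  rcases hG.col_cases hxy with h | h | h
  · exact (vert x hxX y hyX h).1 hx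
  · exact (horiz x hxX y hyX hxy h).1 hx
  · exact (horiz y hyX x hxX hxy.symm h).2 hx

/-- Every assembly in a graph with two rows can be carried out in a comb. -/
theorem exists_comb_fill [Finite V] (hG : TwoRows G row col) {ω : V → C} {X : Set V} {d : C}
    {k : ℕ} (h : Fill G ω id X d k) : ∃ s, Fill (comb G row col s) ω id X d k := by
  classical
  induction k using Nat.strong_induction_on generalizing X d with
  | _ k ih =>
    obtain ⟨Y, hYX, hY, hc⟩ := h.exists_blocks
    obtain ⟨s, hs⟩ := hG.exists_comb_blocks (hY.imp le_rfl fun A _ a ha hA => by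
      obtain ⟨c, b, rfl, hA⟩ := hA
      obtain ⟨s, hs⟩ := ih b (by omega) hA
      exact ⟨s, c, b, rfl, hs⟩)
    -- The new comb keeps `s` at gaps crossed in `Y`, so the blocks survive, and takes any available
    -- edge at the other gaps crossed in `X`, so that `X` stays connected.
    have ht : ∀ j, ∃ i : Fin 2, (Crosses G col Y j → s j = i) ∧
        (Crosses G col X j → ∃ x ∈ X, ∃ y ∈ X, G.Adj x y ∧ row x = i ∧ row y = i ∧
          col x = j ∧ col y = j + 1) := by
      intro j
      by_cases hj : Crosses G col Y j
      · obtain ⟨x, hx, y, hy, hxy, hxj, hyj⟩ := hG.crosses_comb hs hj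
        have h1 := hxy.2.resolve_left (by omega)
        rw [show min (col x) (col y) = j by omega] at h1
        exact ⟨s j, fun _ => rfl, fun _ =>
          ⟨x, hYX hx, y, hYX hy, hxy.1, h1.1, h1.2, hxj, hyj⟩⟩
      · by_cases hj' : Crosses G col X j
        · obtain ⟨x, hx, y, hy, hxy, hxj, hyj⟩ := hj'
          exact ⟨row x, fun h => absurd h hj, fun _ => ⟨x, hx, y, hy, hxy, rfl,
            (hG.row_eq hxy (by omega)).symm, hxj, hyj⟩⟩
        · exact ⟨0, fun h => absurd h hj, fun h => absurd h hj'⟩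
    choose t ht1 ht2 using ht
    refine ⟨t, Fill.of_blocks (hs.imp (comb_le G row col t) fun A hA a _ hAa => ?_) hYX hc
      (hG.conn_comb h.conn fun j hj => ?_) h.nonempty⟩
    · obtain ⟨c, b, rfl, hb⟩ := hG.recoloured_congr hAa fun j hj => ht1 j (hj.mono hA)
      exact hb.recolour d
    · obtain ⟨x, hx, y, hy, hxy, hrx, hry, hxj, hyj⟩ := ht2 j hj
      refine ⟨x, hx, y, hy, ⟨hxy, Or.inr ?_⟩, hxj, hyj⟩
      rw [show min (col x) (col y) = j by omega]
      exact ⟨hrx, hry⟩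

/-! ### The comb as a caterpillar tree. -/

/-- At most one edge of a comb joins two given consecutive columns. -/
theorem comb_edge_unique (hG : TwoRows G row col) {s : ℕ → Fin 2} {x y a b : V}
    (hxy : (comb G row col s).Adj x y) (hab : (comb G row col s).Adj a b)
    (hc : col x + 1 = col y) (hca : col a = col x) (hcb : col b = col y) : x = a ∧ y = b := by
  have h1 := hxy.2.resolve_left (by omega)
  have h2 := hab.2.resolve_left (by omega)
  rw [hca, hcb] at h2
  exact ⟨hG.ext x a (h1.1.trans h2.1.symm) hca.symm, hG.ext y b (h1.2.trans h2.2.symm) hcb.symm⟩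

theorem isAcyclic_comb (hG : TwoRows G row col) (s : ℕ → Fin 2) :
    (comb G row col s).IsAcyclic := by
  -- Every edge is shown to be a bridge: `f` separates its ends and is constant along all other
  -- edges.
  have cut : ∀ (f : V → Prop) (u v : V), (f u ↔ ¬ f v) →
      (∀ a b, (comb G row col s).Adj a b → col a ≤ col b → s(a, b) ≠ s(u, v) → (f a ↔ f b)) →
      ¬ ((comb G row col s) \ SimpleGraph.fromEdgeSet {s(u, v)}).Reachable u v := by
    intro f u v huv hf hr
    have := eq_of_reachable (f := f) (fun a b hab => propext ?_) hr
    · rw [this] at huv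
      tauto
    · rw [SimpleGraph.sdiff_adj, SimpleGraph.fromEdgeSet_adj] at hab
      have hne : s(a, b) ≠ s(u, v) := fun h => hab.2 ⟨h, hab.1.ne⟩
      rcases le_total (col a) (col b) with h | h
      · exact hf a b hab.1 h hne
      · exact (hf b a hab.1.symm h (by rwa [Sym2.eq_swap])).symm
  have horiz : ∀ u v, (comb G row col s).Adj u v → col u + 1 = col v →
      ¬ ((comb G row col s) \ SimpleGraph.fromEdgeSet {s(u, v)}).Reachable u v := by
    intro u v huv hc
    refine cut (fun z => col z ≤ col u) u v (by simp; omega) fun a b hab hle hne => ?_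
    refine ⟨fun h => ?_, fun h => hle.trans h⟩
    by_contra hb
    have := hG.col_cases hab.1
    obtain ⟨rfl, rfl⟩ := hG.comb_edge_unique huv hab hc (by omega) (by omega)
    exact hne rfl
  rw [SimpleGraph.isAcyclic_iff_forall_adj_isBridge]
  intro u v huv
  rw [SimpleGraph.isBridge_iff]
  rcases hG.col_cases huv.1 with hc | hc | hc
  -- For a vertical edge, all columns on one side go with the end in the row of the comb edge
  -- leading there. If `col u = 0`, the truncated subtraction is harmless, as nothing lies to the
  -- left.
  · refine cut (fun z => (col z < col u ∧ s (col u - 1) = row u) ∨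
      (col z = col u ∧ row z = row u) ∨ (col u < col z ∧ s (col u) = row u)) u v ?_ ?_
    · have : row v ≠ row u := fun h => huv.ne (hG.ext u v h.symm hc)
      simp [hc, this]
    · intro a b hab hle hne
      by_cases hcab : col a = col b
      · by_cases hau : col a = col u
        · exfalso
          have hr : row a ≠ row b := fun h => hab.ne (hG.ext a b h hcab)
          have hr' : row u ≠ row v := fun h => huv.ne (hG.ext u v h hc)
          by_cases h : row a = row u
          · rw [hG.ext a u h hau, hG.ext b v (by omega) (by omega)] at hne
            exact hne rfl
          · rw [hG.ext a v (by omega) (by omega), hG.ext b u (by omega) (by omega)] at hne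
            exact hne Sym2.eq_swap
        · simp [← hcab, hau]
      · have h1 := hab.2.resolve_left hcab
        rw [min_eq_left hle] at h1
        have h2 : col a + 1 = col b := by
          have := hG.col_cases hab.1
          omega
        rcases lt_trichotomy (col a) (col u) with h | h | h
        · by_cases h3 : col b = col u
          · have : col u - 1 = col a := by omega
            simp [h, h3, this, h1.2, h.ne, h.not_gt]
          · have : col b < col u := by omega
            simp [h, this, h.ne, this.ne, h.not_gt, this.not_gt]
        · have : col u < col b := by omega
          simp [h, this, this.ne', this.not_gt, h1.1]
        · have : col u < col b := by omega
          simp [h, this, h.ne', this.ne', h.not_gt, this.not_gt]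
  · exact horiz u v huv hc
  · have := horiz v u huv.symm hc
    rw [Sym2.eq_swap]
    exact fun h => this h.symm

/-- In a connected comb, a path between the extreme columns contains all vertices that are not
leaves. -/
theorem mem_support_of_not_isLeaf (hG : TwoRows G row col) {s : ℕ → Fin 2}
    (hT : (comb G row col s).Preconnected) {u w : V} (hu : ∀ x, col u ≤ col x)
    (hw : ∀ x, col x ≤ col w) (p : (comb G row col s).Walk u w) {v : V}
    (hv : ¬ IsLeaf (comb G row col s) v) : v ∈ p.support := by
  by_contra hn
  -- The walk must cross each such gap, and the comb has only one edge there.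
  have horiz : ∀ a b, (comb G row col s).Adj a b → col a + 1 = col b →
      a ∈ p.support ∧ b ∈ p.support := by
    intro a b hab hc
    obtain ⟨e, he, h1, h2⟩ := p.exists_boundary_dart {z | col z ≤ col a} (hu a)
      (fun h : col w ≤ col a => by have := hw b; omega)
    have h1 : col e.fst ≤ col a := h1
    have h2 : ¬ col e.snd ≤ col a := h2
    have := hG.col_cases e.adj.1
    obtain ⟨rfl, rfl⟩ := hG.comb_edge_unique hab e.adj hc (by omega) (by omega)
    exact ⟨p.dart_fst_mem_support_of_mem_darts he, p.dart_snd_mem_support_of_mem_darts he⟩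
  have vert : ∀ y, (comb G row col s).Adj v y → col v = col y := by
    intro y hvy
    rcases hG.col_cases hvy.1 with h | h | h
    · exact h
    · exact absurd (horiz v y hvy h).1 hn
    · exact absurd (horiz y v hvy.symm h).2 hn
  have hvu : v ≠ u := fun h => hn (h ▸ p.start_mem_support)
  -- Connectivity supplies a neighbour of `v`; it is vertical, hence the only one with two rows.
  obtain ⟨q⟩ := hT v u
  cases q with
  | nil => exact hvu rfl
  | @cons _ y _ hvy _ =>
    refine hv ⟨y, hvy, fun z hvz => hG.ext z y ?_ ((vert z hvz).symm.trans (vert y hvy))⟩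
    have h1 : row v ≠ row z := fun h => hvz.ne (hG.ext v z h (vert z hvz))
    have h2 : row v ≠ row y := fun h => hvy.ne (hG.ext v y h (vert y hvy))
    omega

end TwoRows

theorem twoRows_induce_board (n : ℕ) (H : Set (Fin 2 × Fin n)) :
    TwoRows ((board n).induce H) (fun x => x.1.1) (fun x => x.1.2) where
  adj_iff := by
    rintro ⟨⟨i, j⟩, hx⟩ ⟨⟨i', j'⟩, hy⟩
    simp only [SimpleGraph.comap_adj, Function.Embedding.subtype_apply, board,
      SimpleGraph.boxProd_adj, SimpleGraph.pathGraph_adj]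
    omega
  ext := by
    rintro ⟨⟨i, j⟩, hx⟩ ⟨⟨i', j'⟩, hy⟩ h1 h2
    exact Subtype.ext (Prod.ext h1 (Fin.ext h2))

end FloodIt

theorem mainTheorem3 {C : Type*} (n : ℕ) (ω : Fin 2 × Fin n → C)
    (H : Set (Fin 2 × Fin n)) (hH : ((FloodIt.board n).induce H).Connected)
    (u w : H)
    (hu : ∀ x : H, (u : Fin 2 × Fin n).2 ≤ (x : Fin 2 × Fin n).2)
    (hw : ∀ x : H, (x : Fin 2 × Fin n).2 ≤ (w : Fin 2 × Fin n).2)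
    (d : C) :
    ∃ T : SimpleGraph H,
      FloodIt.IsMinimalSpanningTree ((FloodIt.board n).induce H) (fun x : H => ω x) d T ∧
      ∃ p : T.Walk u w, p.IsPath ∧ ∀ v ∈ FloodIt.bare T, v ∈ p.support := by
  have hG := FloodIt.twoRows_induce_board n H
  obtain ⟨s, hs⟩ := hG.exists_comb_fill
    (FloodIt.fill_minMoves hH (fun x : H => ω x) d)
  have hle := FloodIt.comb_le ((FloodIt.board n).induce H) (fun x => x.1.1) (fun x => x.1.2) s
  -- A comb in which the whole vertex set can be assembled is connected.
  have hpre := FloodIt.preconnected_of_conn hs.conn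
  have := hH.nonempty
  have hconn : (FloodIt.comb ((FloodIt.board n).induce H) (fun x => x.1.1)
    (fun x => x.1.2) s).Connected := ⟨hpre⟩
  obtain ⟨p, hp⟩ := (hpre u w).exists_isPath
  refine ⟨_, ⟨⟨hle, hconn, hG.isAcyclic_comb s⟩, le_antisymm ?_ ?_⟩, p, hp,
    fun v hv => hG.mem_support_of_not_isLeaf hpre hu hw p hv⟩
  · exact FloodIt.minMoves_le_of_fill hs
  · exact FloodIt.minMoves_le_of_fill
      ((FloodIt.fill_minMoves hconn _ d).mono_graph fun x _ y _ hxy => hle hxy)
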